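/- Let $R$ be a left Ore domain (a possibly noncommutative domain whose nonzero elements form a left Ore set $S=R\setminus\{0\}$), and let $A=\sigma(R)\langle x_1,\dots,x_n\rangle$, $n\ge 3$, be a quasi-commutative skew PBW extension of $R$. This means that $R\subseteq A$ is a subring; that $A$ is a free left $R$-module with basis the monomials $x_1^{t_1}\cdots x_n^{t_n}$, $t\in\mathbb N^n$; that for all $i$ and all $r\in R\setminus\{0\}$ there is $c_{i,r}\in R\setminus\{0\}$ with $x_i r=c_{i,r}x_i$; and that for all $i,j$ there is $c_{ij}\in R\setminus\{0\}$ with $x_ix_j=c_{ij}x_jx_i$. Assume that the localization $S^{-1}A$ is a general quasi-commutative extension of the division ring $K=S^{-1}R$ in the variables $x_1/1,\dots,x_n/1$. Here "general" means the following. Let $\overline{\sigma}_i\colon K\to K$ be the endomorphism with $\tfrac{x_i}{1}z=\overline{\sigma}_i(z)\tfrac{x_i}{1}$ for all $z\in K$, let $\overline{c}_{ij}\in K$ be the elements with $\tfrac{x_i}{1}\tfrac{x_j}{1}=\overline{c}_{ij}\tfrac{x_j}{1}\tfrac{x_i}{1}$, and let $N$ be the subgroup of $K^*$ generated by $[K^*,K^*]$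 and all $z^{-1}\overline{\sigma}_i(z)$ with $z\in K^*$, $1\le i\le n$. Then all $\overline{c}_{ij}$ are invertible, and the images of the $\overline{c}_{ij}$, $1\le i<j\le n$, are independent in the abelian group $K^*/N$ (no product of integer powers of them with exponents not all zero is trivial). Let $\mathrm{End}(A)$ be the monoid of ring endomorphisms of $A$ that fix every element of $R$, and $\mathrm{Aut}(A)$ the group of its invertible elements. If $\lambda\in\mathrm{End}(A)$ is injective, then there are $\lambda_1,\dots,\lambda_n\in R\setminus\{0\}$ such that $$\lambda(x_w)=\lambda_w x_w\qquad\text{for every } w=1,\dots,n.$$ In particular, every $\lambda\in\mathrm{Aut}(A)$ has this form. -/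

import Mathlib

open scoped nonZeroDivisors commutatorElement

namespace SkewPBW

universe u v

section Basic

variable {R : Type u} {A : Type v} [Ring R] [Ring A] {n : ℕ}

/-- The standard monomial `x₁ ^ t₁ * ⋯ * xₙ ^ tₙ`, the factors being multiplied in this order. -/
def mon (x : Fin n → A) (t : Fin n → ℕ) : A :=
  (List.ofFn fun i => x i ^ t i).prod

/-- `A` is a quasi-commutative skew PBW extension of `R` in the variables `x₁, …, xₙ`.
The inclusion `R ⊆ A` is given by the injective ring homomorphism `ι`. -/
structure IsQuasiCommutative (ι : R →+* A) (x : Fin n → A) : Prop where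
  injective : Function.Injective ι
  /-- `A` is a free left `R`-module with basis the standard monomials. -/
  basis : ∀ f : A, ∃! a : (Fin n → ℕ) →₀ R, f = a.sum fun t r => ι r * mon x t
  /-- `xᵢ r = c xᵢ` with `c ≠ 0`, for all `r ≠ 0`. -/
  var_mul_coeff : ∀ (i : Fin n) (r : R), r ≠ 0 → ∃ c : R, c ≠ 0 ∧ x i * ι r = ι c * x i
  /-- `xⱼ xᵢ = c xᵢ xⱼ` with `c ≠ 0`. -/
  var_mul_var : ∀ i j : Fin n, ∃ c : R, c ≠ 0 ∧ x j * x i = ι c * (x i * x j)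

/-- The subgroup `N` of `Rˣ` generated by the derived subgroup and by all `z⁻¹ σᵢ(z)`, `z ∈ Rˣ`.
Here `σᵢ(z)` is the element `w` of `R` with `xᵢ z = w xᵢ`; it is unique because the monomials are
left linearly independent over `R`. -/
def subgroupN (ι : R →+* A) (x : Fin n → A) : Subgroup Rˣ :=
  Subgroup.closure
    ((commutator Rˣ : Set Rˣ) ∪
      {g | ∃ (i : Fin n) (z w : Rˣ), x i * ι (z : R) = ι (w : R) * x i ∧ g = z⁻¹ * w})

theorem commutator_le_subgroupN (ι : R →+* A) (x : Fin n → A) :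
    commutator Rˣ ≤ subgroupN ι x :=
  fun _ hg => Subgroup.subset_closure (Or.inl hg)

instance subgroupN_normal (ι : R →+* A) (x : Fin n → A) : (subgroupN ι x).Normal where
  conj_mem a ha g := by
    have h : ⁅g, a⁆ ∈ subgroupN ι x :=
      commutator_le_subgroupN ι x
        (Subgroup.commutator_mem_commutator (Subgroup.mem_top g) (Subgroup.mem_top a))
    have h2 := mul_mem h ha
    simpa [commutatorElement_def] using h2

/-- The group `Rˣ / N` is abelian. -/
instance quotientCommGroup (ι : R →+* A) (x : Fin n → A) : CommGroup (Rˣ ⧸ subgroupN ι x) :=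
  { QuotientGroup.Quotient.group (subgroupN ι x) with
    mul_comm := by
      intro a b
      induction a using QuotientGroup.induction_on with
      | H a =>
        induction b using QuotientGroup.induction_on with
        | H b =>
          refine QuotientGroup.eq.mpr (commutator_le_subgroupN ι x ?_)
          have h : ⁅b⁻¹, a⁻¹⁆ ∈ commutator Rˣ :=
            Subgroup.commutator_mem_commutator (Subgroup.mem_top _) (Subgroup.mem_top _)
          simpa [commutatorElement_def, mul_assoc] using h }

/-- The extension is general: all the elements `c i j` of `R` with `xᵢ xⱼ = (c i j) xⱼ xᵢ` are
invertible, and the images of the `c i j` with `i < j` are independent in the abelian group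
`Rˣ / N` (no nontrivial product of integer powers of them is trivial). In a quasi-commutative extension the
family `c` of invertible elements is uniquely determined by the `xᵢ`. -/
def IsGeneral (ι : R →+* A) (x : Fin n → A) : Prop :=
  ∃ c : Fin n → Fin n → Rˣ,
    (∀ i j, x i * x j = ι (c i j : R) * (x j * x i)) ∧
    LinearIndependent ℤ fun p : {p : Fin n × Fin n // p.1 < p.2} =>
      Additive.ofMul (QuotientGroup.mk (c p.1.1 p.1.2) : Rˣ ⧸ subgroupN ι x)

/-- `End(A)`: the monoid of ring endomorphisms of `A` that fix the elements of `R`. -/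
def End (ι : R →+* A) : Submonoid (A →+* A) where
  carrier := {f | ∀ r, f (ι r) = ι r}
  one_mem' := fun _ => rfl
  mul_mem' := fun {f g} hf hg r => by
    change f (g (ι r)) = ι r
    rw [hg r, hf r]

/-- `Aut(A)`: the group of invertible elements of `End(A)`. -/
abbrev Aut (ι : R →+* A) : Type v := (End ι)ˣ

end Basic

section Localization

variable {R : Type u} {A : Type v} [Ring R] [Ring A] {n : ℕ} {ι : R →+* A} {x : Fin n → A}

theorem mon_mul_coeff (h : IsQuasiCommutative ι x) (t : Fin n → ℕ) (r : R) (hr : r ≠ 0) :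
    ∃ c : R, c ≠ 0 ∧ mon x t * ι r = ι c * mon x t := by
  let T : Submonoid A :=
    { carrier := {a | ∀ r : R, r ≠ 0 → ∃ c : R, c ≠ 0 ∧ a * ι r = ι c * a}
      one_mem' := fun r hr => ⟨r, hr, by simp⟩
      mul_mem' := by
        intro a b ha hb r hr
        obtain ⟨c, hc, hbc⟩ := hb r hr
        obtain ⟨d, hd, had⟩ := ha c hc
        exact ⟨d, hd, by rw [mul_assoc, hbc, ← mul_assoc, had, mul_assoc]⟩ }
  have hT : mon x t ∈ T := by
    refine Submonoid.list_prod_mem _ fun a ha => ?_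
    obtain ⟨i, rfl⟩ := (List.mem_ofFn' _ _).mp ha
    exact T.pow_mem (h.var_mul_coeff i) (t i)
  exact hT r hr

theorem eq_zero_of_mul_coeff [IsDomain R] (h : IsQuasiCommutative ι x) (f : A) (s : R)
    (hs : s ≠ 0) (hf : f * ι s = 0) : f = 0 := by
  obtain ⟨a, ha, -⟩ := h.basis f
  choose c hc hcs using fun t => mon_mul_coeff h t s hs
  let b : (Fin n → ℕ) →₀ R :=
    Finsupp.onFinset a.support (fun t => a t * c t) fun t ht =>
      Finsupp.mem_support_iff.mpr (left_ne_zero_of_mul ht)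
  have hb : (0 : A) = b.sum fun t r => ι r * mon x t := by
    rw [Finsupp.onFinset_sum _ (by simp), ← hf, ha, Finsupp.sum, Finset.sum_mul]
    refine Finset.sum_congr rfl fun t _ => ?_
    rw [mul_assoc, hcs, map_mul, mul_assoc]
  have hb0 : b = 0 := (h.basis 0).unique hb (by simp)
  have ha0 : a = 0 := by
    ext t
    have h1 : a t * c t = 0 := DFunLike.congr_fun hb0 t
    simpa [hc t] using h1
  rw [ha, ha0, Finsupp.sum_zero_index]

variable [IsDomain R] [OreLocalization.OreSet R⁰]

theorem exists_left_common_mul (h : IsQuasiCommutative ι x) (s : R⁰) (f : A) :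
    ∃ (g : A) (u : R⁰), ι (u : R) * f = g * ι (s : R) := by
  have hs : (s : R) ≠ 0 := nonZeroDivisors.ne_zero s.2
  obtain ⟨a, ha, -⟩ := h.basis f
  rw [ha]
  refine Finset.sum_induction _
    (fun f : A => ∃ (g : A) (u : R⁰), ι (u : R) * f = g * ι (s : R)) ?_ ⟨0, 1, by simp⟩ ?_
  · rintro f₁ f₂ ⟨g₁, u₁, h₁⟩ ⟨g₂, u₂, h₂⟩
    obtain ⟨p, q, hpq⟩ := OreLocalization.oreCondition (u₁ : R) u₂
    refine ⟨ι (q : R) * g₁ + ι p * g₂, q * u₁, ?_⟩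
    have e₁ : ι ((q * u₁ : R⁰) : R) * f₁ = ι (q : R) * g₁ * ι (s : R) := by
      rw [Submonoid.coe_mul, map_mul, mul_assoc, h₁, mul_assoc]
    have e₂ : ι ((q * u₁ : R⁰) : R) * f₂ = ι p * g₂ * ι (s : R) := by
      rw [Submonoid.coe_mul, hpq, map_mul, mul_assoc, h₂, mul_assoc]
    rw [mul_add, add_mul, e₁, e₂]
  · intro t _
    obtain ⟨c, hc, hcs⟩ := mon_mul_coeff h t s hs
    obtain ⟨p, q, hpq⟩ :=
      OreLocalization.oreCondition (a t) (⟨c, mem_nonZeroDivisors_of_ne_zero hc⟩ : R⁰)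
    refine ⟨ι p * mon x t, q, ?_⟩
    change (q : R) * a t = p * c at hpq
    rw [← mul_assoc, ← map_mul, hpq, map_mul, mul_assoc, ← hcs, mul_assoc]

/-- For a left Ore domain `R`, the image in `A` of the set `S = R ∖ {0}`. -/
abbrev denoms (ι : R →+* A) : Submonoid A := R⁰.map ι

/-- `S = R ∖ {0}` satisfies the left Ore condition in `A`. -/
@[reducible]
noncomputable def oreSet (h : IsQuasiCommutative ι x) : OreLocalization.OreSet (denoms ι) :=
  Nonempty.some <| OreLocalization.nonempty_oreSet_iff.mpr <| by
    constructor
    · rintro f g ⟨_, s, hs, rfl⟩ hfg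
      have h0 : f - g = 0 := eq_zero_of_mul_coeff h (f - g) s (nonZeroDivisors.ne_zero hs) <| by
        rw [sub_mul]
        exact sub_eq_zero.mpr hfg
      exact ⟨1, by rw [sub_eq_zero.mp h0]⟩
    · rintro f ⟨_, s, hs, rfl⟩
      obtain ⟨g, u, hu⟩ := exists_left_common_mul h ⟨s, hs⟩ f
      exact ⟨g, ⟨ι u, u, u.2, rfl⟩, hu⟩

/-- The division ring of left fractions `S⁻¹R`, where `S = R ∖ {0}`. -/
abbrev FracR (R : Type u) [Ring R] [IsDomain R] [OreLocalization.OreSet R⁰] : Type u :=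
  OreLocalization R⁰ R

/-- The left Ore localization `S⁻¹A`, where `S = R ∖ {0}`. -/
def Loc (h : IsQuasiCommutative ι x) : Type v :=
  letI := oreSet h
  OreLocalization (denoms ι) A

noncomputable instance (h : IsQuasiCommutative ι x) : Ring (Loc h) :=
  letI := oreSet h
  inferInstanceAs (Ring (OreLocalization (denoms ι) A))

/-- The canonical homomorphism `A → S⁻¹A`, `a ↦ a / 1`. -/
noncomputable def toLoc (h : IsQuasiCommutative ι x) : A →+* Loc h :=
  letI := oreSet h
  (OreLocalization.numeratorRingHom : A →+* OreLocalization (denoms ι) A)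

/-- The elements of `S` become units in `S⁻¹A`. -/
noncomputable def denomUnit (h : IsQuasiCommutative ι x) : R⁰ →* (Loc h)ˣ :=
  letI := oreSet h
  { toFun := fun s =>
      (OreLocalization.numeratorUnit (⟨ι s, s, s.2, rfl⟩ : denoms ι) :
        (OreLocalization (denoms ι) A)ˣ)
    map_one' := Units.ext <| by
      change toLoc h (ι ((1 : R⁰) : R)) = 1
      simp
    map_mul' := fun s t => Units.ext <| by
      change toLoc h (ι ((s * t : R⁰) : R)) = toLoc h (ι s) * toLoc h (ι t)
      simp }

/-- The canonical homomorphism `S⁻¹R → S⁻¹A`, `s⁻¹ r ↦ (ι s)⁻¹ (ι r)`. -/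
noncomputable def coeffLoc (h : IsQuasiCommutative ι x) : FracR R →+* Loc h :=
  OreLocalization.universalHom ((toLoc h).comp ι) (denomUnit h) fun _ => rfl

end Localization

end SkewPBW

namespace SkewPBW

/-! ### Exponent vectors: 2×2 minors and extremal exponents -/

section Exponents

/-! Modulo `N`, moving a nonzero coefficient past a variable does not change its class, so the class
in `Kˣ / N` of a commutation factor of two terms depends only on their exponents: it is `∏ γ p q ^
(s p * t q)`, where `γ p q` is the class of `c p q`. An injective `λ` fixing `R` sends the `x i` to
nonzero `y i` satisfying the same relations. Comparing lex-extremal terms in `y i * y j = d * (y j *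
y i)` gives `γ i j = ∏ γ p q ^ (t i p * t j q)`, with `t i` the extremal exponent of `y i`
(`SkewCommute.value_eq`).

Since `γ` is alternating, only the 2×2 minors of the matrix `t` enter, and independence makes them
equal to those of the identity. For `n ≥ 3` and natural entries this forces `t = 1`
(`eq_single_of_minors_eq`). The argument applies to largest and to smallest exponents alike, so both
equal the exponent of `x i` and `y i` is a single term. -/

theorem sum_mul_smul_eq_sum_lt {V : Type*} [AddCommGroup V] {n : ℕ} (γ : Fin n → Fin n → V)
    (hdiag : ∀ i, γ i i = 0) (hanti : ∀ i j, γ j i = -γ i j) (a b : Fin n → ℕ) :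
    ∑ p, ∑ q, (a p * b q) • γ p q =
      ∑ p : {p : Fin n × Fin n // p.1 < p.2},
        ((a p.1.1 : ℤ) * b p.1.2 - a p.1.2 * b p.1.1) • γ p.1.1 p.1.2 := by
  have hsplit (p : Fin n × Fin n) : (a p.1 * b p.2) • γ p.1 p.2 =
      (if p.1 < p.2 then (a p.1 * b p.2) • γ p.1 p.2 else 0) +
        if p.2 < p.1 then (a p.1 * b p.2) • γ p.1 p.2 else 0 := by
    rcases lt_trichotomy p.1 p.2 with h | h | h
    · simp [h, h.not_gt]
    · simp [h, hdiag]
    · simp [h, h.not_gt]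
  have hswap : (∑ p : Fin n × Fin n, if p.2 < p.1 then (a p.1 * b p.2) • γ p.1 p.2 else 0) =
      ∑ p : Fin n × Fin n, if p.1 < p.2 then (a p.2 * b p.1) • γ p.2 p.1 else 0 :=
    Fintype.sum_equiv (Equiv.prodComm _ _) _ _ fun _ => rfl
  rw [← Fintype.sum_prod_type' (f := fun p q => (a p * b q) • γ p q),
    Finset.sum_congr rfl fun p _ => hsplit p, Finset.sum_add_distrib, hswap,
    ← Finset.sum_add_distrib,
    ← Finset.sum_subtype (Finset.univ.filter fun p : Fin n × Fin n => p.1 < p.2) (by simp)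
      (fun p => ((a p.1 : ℤ) * b p.2 - a p.2 * b p.1) • γ p.1 p.2), Finset.sum_filter]
  refine Finset.sum_congr rfl fun p _ => ?_
  split_ifs
  · rw [hanti p.1 p.2, sub_smul, smul_neg, ← sub_eq_add_neg]
    congr 1 <;> rw [← natCast_zsmul] <;> push_cast <;> rfl
  · simp

/-- A third index makes every off-diagonal entry vanish. The diagonal entries then have pairwise
products 1, and being natural numbers they are 1; over `ℤ` the matrix `-1` would also qualify. -/
theorem eq_single_of_minors_eq {n : ℕ} (hn : 3 ≤ n) (t : Fin n → Fin n → ℕ)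
    (h : ∀ i j p q, (t i p : ℤ) * t j q - t i q * t j p =
      (Pi.single i 1 : Fin n → ℕ) p * (Pi.single j 1 : Fin n → ℕ) q -
        (Pi.single i 1 : Fin n → ℕ) q * (Pi.single j 1 : Fin n → ℕ) p) (i : Fin n) :
    t i = Pi.single i 1 := by
  have exists_third (i p : Fin n) : ∃ j, j ≠ i ∧ j ≠ p := by
    have : ({i, p} : Finset (Fin n)).card < (Finset.univ : Finset (Fin n)).card :=
      (Finset.card_le_two).trans_lt (by simp only [Finset.card_univ, Fintype.card_fin]; omega)
    obtain ⟨j, -, hj⟩ := Finset.exists_mem_notMem_of_card_lt_card this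
    exact ⟨j, by simpa using hj⟩
  have hoff (i p : Fin n) (hp : p ≠ i) : t i p = 0 := by
    obtain ⟨j, hji, hjp⟩ := exists_third i p
    have h1 := h i j i j
    have h2 := h i j p j
    have h3 := h i j p i
    simp only [Pi.single_apply, hji, hp, hji.symm, hjp.symm, if_true, if_false]
      at h1 h2 h3
    push_cast at h1 h2 h3
    have : (t i p : ℤ) = 0 := by
      -- A 3×3 determinant with rows `t i`, `t i`, `t j` and columns `p`, `i`, `j` is zero; it is
      -- expanded along its first row.
      linear_combination (-(t i p : ℤ)) * h1 + (t i i : ℤ) * h2 - (t i j : ℤ) * h3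
    exact_mod_cast this
  funext p
  by_cases hp : p = i
  · subst hp
    obtain ⟨j, hj, -⟩ := exists_third p p
    have h1 := h p j p j
    rw [hoff p j hj] at h1
    simp only [Pi.single_apply, hj, hj.symm, if_true, if_false] at h1
    have h2 : t p p * t j j = 1 := by
      push_cast at h1
      zify
      linarith
    simpa using Nat.eq_one_of_mul_eq_one_right h2
  · rw [hoff i p hp, Pi.single_apply, if_neg hp]

theorem eq_single_of_linearIndependent {V : Type*} [AddCommGroup V] {n : ℕ} (hn : 3 ≤ n)
    (γ : Fin n → Fin n → V) (hdiag : ∀ i, γ i i = 0) (hanti : ∀ i j, γ j i = -γ i j)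
    (hγ : LinearIndependent ℤ fun p : {p : Fin n × Fin n // p.1 < p.2} => γ p.1.1 p.1.2)
    (t : Fin n → Fin n → ℕ) (h : ∀ i j, γ i j = ∑ p, ∑ q, (t i p * t j q) • γ p q) (i : Fin n) :
    t i = Pi.single i 1 := by
  have key (i j : Fin n) (p : {p : Fin n × Fin n // p.1 < p.2}) := by
    have h1 : ∑ p, ∑ q, ((Pi.single i 1 : Fin n → ℕ) p * (Pi.single j 1 : Fin n → ℕ) q) • γ p q =
        γ i j := by
      simp [Pi.single_apply]
    have h2 := (h i j).symm.trans h1.symm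
    rw [sum_mul_smul_eq_sum_lt γ hdiag hanti, sum_mul_smul_eq_sum_lt γ hdiag hanti,
      ← sub_eq_zero, ← Finset.sum_sub_distrib] at h2
    simp only [← sub_smul] at h2
    exact Fintype.linearIndependent_iff.mp hγ _ h2 p
  refine eq_single_of_minors_eq hn t (fun i j p q => ?_) i
  rcases lt_trichotomy p q with hpq | rfl | hpq
  · exact sub_eq_zero.mp (key i j ⟨(p, q), hpq⟩)
  · ring
  · have := key i j ⟨(q, p), hpq⟩
    dsimp only at this
    linear_combination -this

/-- The lexicographic order is a linear order strictly compatible with addition, so a sum of two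
maxima is attained only once. -/
theorem uniqueAdd_of_toLex_le {n : ℕ} {S T : Finset (Fin n → ℕ)} {s t : Fin n → ℕ}
    (hs : ∀ a ∈ S, toLex a ≤ toLex s) (ht : ∀ b ∈ T, toLex b ≤ toLex t) : UniqueAdd S T s t :=
  fun a b ha hb hab =>
    (add_eq_add_iff_eq_and_eq (hs a ha) (ht b hb)).mp (congrArg toLex hab)

theorem uniqueAdd_of_le_toLex {n : ℕ} {S T : Finset (Fin n → ℕ)} {s t : Fin n → ℕ}
    (hs : ∀ a ∈ S, toLex s ≤ toLex a) (ht : ∀ b ∈ T, toLex t ≤ toLex b) : UniqueAdd S T s t :=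
  fun a b ha hb hab =>
    have h := (add_eq_add_iff_eq_and_eq (hs a ha) (ht b hb)).mp (congrArg toLex hab.symm)
    ⟨h.1.symm, h.2.symm⟩

end Exponents

end SkewPBW

namespace SkewPBW

/-! ### Commutation up to coefficients with controlled class -/

section SkewCommutation

variable {R A G : Type*} [Ring R] [Ring A] [CommGroup G]

/-- `a r = r' a` for every nonzerodivisor `r`, where `r'` is a nonzerodivisor with the same value
under `φ`. -/
def SkewNormal (ι : R →+* A) (φ : R⁰ →* G) (a : A) : Prop :=
  ∀ r : R⁰, ∃ c : R⁰, φ c = φ r ∧ a * ι r = ι c * a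

/-- `a b = d b a` for a nonzerodivisor `d` with value `g` under `φ`. -/
def SkewCommute (ι : R →+* A) (φ : R⁰ →* G) (a b : A) (g : G) : Prop :=
  ∃ d : R⁰, φ d = g ∧ a * b = ι d * (b * a)

variable {ι : R →+* A} {φ : R⁰ →* G} {a a' b b' : A} {g g' : G}

theorem SkewNormal.one : SkewNormal ι φ 1 := fun r => ⟨r, rfl, by simp⟩

theorem SkewNormal.mul (ha : SkewNormal ι φ a) (hb : SkewNormal ι φ b) :
    SkewNormal ι φ (a * b) := by
  intro r
  obtain ⟨c, hc, hbc⟩ := hb r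
  obtain ⟨d, hd, had⟩ := ha c
  exact ⟨d, hd.trans hc, by rw [mul_assoc, hbc, ← mul_assoc, had, mul_assoc]⟩

theorem SkewNormal.pow (ha : SkewNormal ι φ a) (k : ℕ) : SkewNormal ι φ (a ^ k) := by
  induction k with
  | zero => simpa using SkewNormal.one
  | succ k ih => rw [pow_succ]; exact ih.mul ha

theorem SkewNormal.mon {n : ℕ} {x : Fin n → A} (hx : ∀ i, SkewNormal ι φ (x i))
    (t : Fin n → ℕ) : SkewNormal ι φ (mon x t) := by
  let T : Submonoid A :=
    { carrier := {a | SkewNormal ι φ a}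
      one_mem' := SkewNormal.one
      mul_mem' := SkewNormal.mul }
  refine T.list_prod_mem fun a ha => ?_
  obtain ⟨i, rfl⟩ := (List.mem_ofFn' _ _).mp ha
  exact (hx i).pow (t i)

theorem SkewCommute.one_right : SkewCommute ι φ a 1 1 := ⟨1, by simp, by simp⟩

theorem SkewCommute.one_left : SkewCommute ι φ 1 b 1 := ⟨1, by simp, by simp⟩

theorem SkewCommute.mul_right (hb : SkewNormal ι φ b) (h : SkewCommute ι φ a b g)
    (h' : SkewCommute ι φ a b' g') : SkewCommute ι φ a (b * b') (g * g') := by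
  obtain ⟨d, hd, e⟩ := h
  obtain ⟨d', hd', e'⟩ := h'
  obtain ⟨c, hc, hbc⟩ := hb d'
  refine ⟨d * c, by rw [map_mul, hd, hc, hd'], ?_⟩
  calc a * (b * b') = ι d * (b * (a * b')) := by rw [← mul_assoc, e, mul_assoc, mul_assoc]
    _ = ι d * (b * ι d' * (b' * a)) := by rw [e', mul_assoc]
    _ = ι (d * c : R⁰) * (b * b' * a) := by rw [hbc]; simp [mul_assoc]

theorem SkewCommute.mul_left (ha : SkewNormal ι φ a) (h : SkewCommute ι φ a b g)
    (h' : SkewCommute ι φ a' b g') : SkewCommute ι φ (a * a') b (g * g') := by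
  obtain ⟨d, hd, e⟩ := h
  obtain ⟨d', hd', e'⟩ := h'
  obtain ⟨c, hc, hac⟩ := ha d'
  refine ⟨c * d, by rw [map_mul, hd, hc, hd', mul_comm], ?_⟩
  calc a * a' * b = a * ι d' * (b * a') := by rw [mul_assoc, e', mul_assoc]
    _ = ι c * (a * b * a') := by rw [hac]; simp [mul_assoc]
    _ = ι (c * d : R⁰) * (b * (a * a')) := by rw [e]; simp [mul_assoc]

theorem SkewCommute.pow_right (hb : SkewNormal ι φ b) (h : SkewCommute ι φ a b g) (k : ℕ) :
    SkewCommute ι φ a (b ^ k) (g ^ k) := by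
  induction k with
  | zero => simpa using SkewCommute.one_right
  | succ k ih => rw [pow_succ, pow_succ]; exact ih.mul_right (hb.pow k) h

theorem SkewCommute.pow_left (ha : SkewNormal ι φ a) (h : SkewCommute ι φ a b g) (k : ℕ) :
    SkewCommute ι φ (a ^ k) b (g ^ k) := by
  induction k with
  | zero => simpa using SkewCommute.one_left
  | succ k ih => rw [pow_succ, pow_succ]; exact ih.mul_left (ha.pow k) h

theorem mon_succ {n : ℕ} (x : Fin (n + 1) → A) (t : Fin (n + 1) → ℕ) :
    mon x t = x 0 ^ t 0 * mon (Fin.tail x) (Fin.tail t) := by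
  simp [mon, List.ofFn_succ, Fin.tail]

theorem SkewCommute.mon_right {n : ℕ} {x : Fin n → A} (hx : ∀ i, SkewNormal ι φ (x i))
    {γ : Fin n → G} (h : ∀ i, SkewCommute ι φ a (x i) (γ i)) (t : Fin n → ℕ) :
    SkewCommute ι φ a (mon x t) (∏ i, γ i ^ t i) := by
  induction n with
  | zero => simpa [mon] using SkewCommute.one_right
  | succ n ih =>
    rw [mon_succ, Fin.prod_univ_succ]
    exact ((h 0).pow_right (hx 0) _).mul_right ((hx 0).pow _)
      (ih (x := Fin.tail x) (γ := Fin.tail γ) (fun i => hx i.succ) (fun i => h i.succ) _)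

theorem SkewCommute.mon_left {n : ℕ} {x : Fin n → A} (hx : ∀ i, SkewNormal ι φ (x i))
    {γ : Fin n → G} (h : ∀ i, SkewCommute ι φ (x i) b (γ i)) (t : Fin n → ℕ) :
    SkewCommute ι φ (mon x t) b (∏ i, γ i ^ t i) := by
  induction n with
  | zero => simpa [mon] using SkewCommute.one_left
  | succ n ih =>
    rw [mon_succ, Fin.prod_univ_succ]
    exact ((h 0).pow_left (hx 0) _).mul_left ((hx 0).pow _)
      (ih (x := Fin.tail x) (γ := Fin.tail γ) (fun i => hx i.succ) (fun i => h i.succ) _)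

theorem SkewCommute.mon_mon {n : ℕ} {x : Fin n → A} (hx : ∀ i, SkewNormal ι φ (x i))
    {γ : Fin n → Fin n → G} (h : ∀ i j, SkewCommute ι φ (x i) (x j) (γ i j)) (s t : Fin n → ℕ) :
    SkewCommute ι φ (mon x s) (mon x t) (∏ p, ∏ q, γ p q ^ (s p * t q)) := by
  have := SkewCommute.mon_left hx (fun i => SkewCommute.mon_right hx (h i) t) s
  simpa only [← Finset.prod_pow, ← pow_mul, mul_comm (t _)] using this

/-- The class of `k` is not tracked: it occurs on both sides of the later comparison and cancels. -/
theorem mon_mul_mon {n : ℕ} {x : Fin n → A} (hx : ∀ i, SkewNormal ι φ (x i))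
    {γ : Fin n → Fin n → G} (h : ∀ i j, SkewCommute ι φ (x i) (x j) (γ i j)) (s t : Fin n → ℕ) :
    ∃ k : R⁰, mon x s * mon x t = ι k * mon x (s + t) := by
  induction n with
  | zero => exact ⟨1, by simp [mon]⟩
  | succ n ih =>
    obtain ⟨k, hk⟩ := ih (x := Fin.tail x) (γ := fun i j => γ i.succ j.succ) (fun i => hx i.succ)
      (fun i j => h i.succ j.succ) (Fin.tail s) (Fin.tail t)
    obtain ⟨d, -, hd⟩ := SkewCommute.mon_left (x := Fin.tail x) (fun i => hx i.succ)
      (fun i => (h i.succ 0).pow_right (hx 0) (t 0)) (Fin.tail s)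
    obtain ⟨c, -, hc⟩ := (hx 0).pow (s 0) d
    obtain ⟨e, -, he⟩ := (hx 0).pow (s 0 + t 0) k
    refine ⟨c * e, ?_⟩
    rw [mon_succ, mon_succ, mon_succ]
    change _ = _ * (x 0 ^ (s 0 + t 0) * mon (Fin.tail x) (Fin.tail s + Fin.tail t))
    generalize mon (Fin.tail x) (Fin.tail s) = u at *
    generalize mon (Fin.tail x) (Fin.tail t) = v at *
    generalize mon (Fin.tail x) (Fin.tail s + Fin.tail t) = w at *
    calc x 0 ^ s 0 * u * (x 0 ^ t 0 * v) = x 0 ^ s 0 * (u * x 0 ^ t 0) * v := by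
          simp only [mul_assoc]
      _ = x 0 ^ s 0 * ι d * (x 0 ^ t 0 * (u * v)) := by rw [hd]; simp only [mul_assoc]
      _ = ι c * (x 0 ^ (s 0 + t 0) * ι k) * w := by
          rw [hc, hk, pow_add]; simp only [mul_assoc]
      _ = ι (c * e : R⁰) * (x 0 ^ (s 0 + t 0) * w) := by rw [he]; simp [mul_assoc]

/-- `a` is a nonzero term of exponent `t` whose coefficient has value `g` under `φ`. -/
def IsTerm (ι : R →+* A) (φ : R⁰ →* G) {n : ℕ} (x : Fin n → A) (t : Fin n → ℕ) (g : G)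
    (a : A) : Prop :=
  ∃ r : R⁰, φ r = g ∧ a = ι r * mon x t

theorem IsTerm.mul {n : ℕ} {x : Fin n → A} (hx : ∀ i, SkewNormal ι φ (x i))
    {s t : Fin n → ℕ} {k : G} (hst : IsTerm ι φ x (s + t) k (mon x s * mon x t))
    (ha : IsTerm ι φ x s g a) (hb : IsTerm ι φ x t g' b) :
    IsTerm ι φ x (s + t) (g * g' * k) (a * b) := by
  obtain ⟨p, hp, rfl⟩ := ha
  obtain ⟨q, hq, rfl⟩ := hb
  obtain ⟨k', hk', e⟩ := hst
  obtain ⟨c, hc, hcq⟩ := SkewNormal.mon hx s q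
  refine ⟨p * c * k', by simp [hp, hq, hc, hk'], ?_⟩
  calc ι p * mon x s * (ι q * mon x t) = ι p * (mon x s * ι q) * mon x t := by
        simp only [mul_assoc]
    _ = ι p * ι c * (mon x s * mon x t) := by rw [hcq]; simp only [mul_assoc]
    _ = _ := by rw [e]; simp [mul_assoc]

theorem IsTerm.coeff_mul {n : ℕ} {x : Fin n → A} {t : Fin n → ℕ} (ha : IsTerm ι φ x t g a)
    (d : R⁰) : IsTerm ι φ x t (φ d * g) (ι d * a) := by
  obtain ⟨r, hr, rfl⟩ := ha
  exact ⟨d * r, by simp [hr], by simp [mul_assoc]⟩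

end SkewCommutation

/-! ### Coefficients in the monomial basis -/

section Expansion

variable {R A : Type*} [Ring R] [Ring A] {n : ℕ} {ι : R →+* A} {x : Fin n → A}

/-- The element of `A` with prescribed coefficients with respect to the standard monomials. -/
noncomputable def ofCoeffs (ι : R →+* A) (x : Fin n → A) : ((Fin n → ℕ) →₀ R) →+ A :=
  Finsupp.liftAddHom fun t => (AddMonoidHom.mulRight (mon x t)).comp ι.toAddMonoidHom

theorem ofCoeffs_apply (a : (Fin n → ℕ) →₀ R) :
    ofCoeffs ι x a = a.sum fun t r => ι r * mon x t := rfl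

theorem ofCoeffs_single (t : Fin n → ℕ) (r : R) :
    ofCoeffs ι x (Finsupp.single t r) = ι r * mon x t := by
  simp [ofCoeffs_apply]

theorem ofCoeffs_smul (r : R) (a : (Fin n → ℕ) →₀ R) :
    ofCoeffs ι x (r • a) = ι r * ofCoeffs ι x a := by
  rw [ofCoeffs_apply, ofCoeffs_apply, Finsupp.sum_smul_index (by simp), Finsupp.mul_sum]
  simp only [map_mul, mul_assoc]

theorem IsQuasiCommutative.ofCoeffs_injective (h : IsQuasiCommutative ι x) :
    Function.Injective (ofCoeffs ι x) := fun a _ hab =>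
  (h.basis (ofCoeffs ι x a)).unique rfl hab

theorem IsQuasiCommutative.exists_ofCoeffs (h : IsQuasiCommutative ι x) (f : A) :
    ∃ a, f = ofCoeffs ι x a :=
  (h.basis f).exists

theorem IsQuasiCommutative.coeff_injective (h : IsQuasiCommutative ι x) {t : Fin n → ℕ} {r s : R}
    (hrs : ι r * mon x t = ι s * mon x t) : r = s := by
  rw [← ofCoeffs_single, ← ofCoeffs_single] at hrs
  exact Finsupp.single_injective t (h.ofCoeffs_injective hrs)

theorem mon_single (i : Fin n) : mon x (Pi.single i 1) = x i := by
  induction n with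
  | zero => exact i.elim0
  | succ n ih =>
    rw [mon_succ]
    cases i using Fin.cases with
    | zero =>
      have : Fin.tail (Pi.single (0 : Fin (n + 1)) 1 : Fin (n + 1) → ℕ) = 0 := by
        funext j; simp [Fin.tail]
      simp [this, mon]
    | succ i =>
      have : Fin.tail (Pi.single i.succ 1 : Fin (n + 1) → ℕ) = Pi.single i 1 := by
        funext j; simp [Fin.tail, Pi.single_apply]
      rw [this, ih]
      simp [Fin.tail]

/-- If an exponent of a product arises from only one pair of exponents of the factors, then the
corresponding term of the product is the product of the corresponding terms. -/
theorem IsQuasiCommutative.term_mul (h : IsQuasiCommutative ι x)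
    (hmul : ∀ s t (p q : R), ∃ r, ι p * mon x s * (ι q * mon x t) = ι r * mon x (s + t))
    {a b c : (Fin n → ℕ) →₀ R} (habc : ofCoeffs ι x a * ofCoeffs ι x b = ofCoeffs ι x c)
    {s t : Fin n → ℕ} (hs : s ∈ a.support) (ht : t ∈ b.support)
    (hst : UniqueAdd a.support b.support s t) :
    ι (c (s + t)) * mon x (s + t) = ι (a s) * mon x s * (ι (b t) * mon x t) := by
  choose e he using fun s t => hmul s t (a s) (b t)
  have hc : c = ∑ s ∈ a.support, ∑ t ∈ b.support, Finsupp.single (s + t) (e s t) := by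
    refine h.ofCoeffs_injective ?_
    rw [← habc, ofCoeffs_apply, ofCoeffs_apply, Finsupp.sum, Finsupp.sum, Finset.sum_mul_sum]
    simp only [map_sum, ofCoeffs_single, he]
  rw [he, hc, Finsupp.finsetSum_apply, Finset.sum_eq_single_of_mem s hs,
    Finsupp.finsetSum_apply, Finset.sum_eq_single_of_mem t ht, Finsupp.single_eq_same]
  · intro t' ht' hne
    exact Finsupp.single_eq_of_ne' fun e => hne (hst hs ht' e).2
  · intro s' hs' hne
    rw [Finsupp.finsetSum_apply]
    exact Finset.sum_eq_zero fun t' ht' =>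
      Finsupp.single_eq_of_ne' fun e => hne (hst hs' ht' e).1

end Expansion

end SkewPBW

namespace SkewPBW

/-! ### Extremal terms of skew-commuting elements -/

section LeadingTerms

variable {R A G : Type*} [Ring R] [IsDomain R] [Ring A] [CommGroup G] {n : ℕ} {ι : R →+* A}
  {φ : R⁰ →* G} {x : Fin n → A} {γ : Fin n → Fin n → G}

omit [IsDomain R] in
theorem IsTerm.value_unique (h : IsQuasiCommutative ι x) {t : Fin n → ℕ} {g g' : G} {a : A}
    (ha : IsTerm ι φ x t g a) (ha' : IsTerm ι φ x t g' a) : g = g' := by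
  obtain ⟨r, rfl, rfl⟩ := ha
  obtain ⟨s, rfl, hs⟩ := ha'
  rw [Subtype.ext (h.coeff_injective hs)]

theorem exists_term_mul (hx : ∀ i, SkewNormal ι φ (x i))
    (hγ : ∀ i j, SkewCommute ι φ (x i) (x j) (γ i j)) (s t : Fin n → ℕ) (p q : R) :
    ∃ r, ι p * mon x s * (ι q * mon x t) = ι r * mon x (s + t) := by
  by_cases hp : p = 0
  · exact ⟨0, by simp [hp]⟩
  by_cases hq : q = 0
  · exact ⟨0, by simp [hq]⟩
  obtain ⟨k, hk⟩ := mon_mul_mon hx hγ s t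
  obtain ⟨r, -, hr⟩ := IsTerm.mul (φ := φ) hx ⟨k, rfl, hk⟩
    ⟨⟨p, mem_nonZeroDivisors_of_ne_zero hp⟩, rfl, rfl⟩
    ⟨⟨q, mem_nonZeroDivisors_of_ne_zero hq⟩, rfl, rfl⟩
  exact ⟨r, hr⟩

/-- The two orders of multiplication give two expressions for the term of exponent `s + t`. In the
abelian group `G` the classes of the coefficients `a s`, `b t` and of the monomial product cancel,
leaving only the commutation factors. -/
theorem SkewCommute.value_eq (h : IsQuasiCommutative ι x) (hx : ∀ i, SkewNormal ι φ (x i))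
    (hγ : ∀ i j, SkewCommute ι φ (x i) (x j) (γ i j)) {a b : (Fin n → ℕ) →₀ R} {g : G}
    (hab : SkewCommute ι φ (ofCoeffs ι x a) (ofCoeffs ι x b) g) {s t : Fin n → ℕ}
    (hs : s ∈ a.support) (ht : t ∈ b.support) (hst : UniqueAdd a.support b.support s t)
    (hts : UniqueAdd b.support a.support t s) :
    g = ∏ p, ∏ q, γ p q ^ (s p * t q) := by
  obtain ⟨d, rfl, hd⟩ := hab
  obtain ⟨c, hc⟩ := h.exists_ofCoeffs (ofCoeffs ι x b * ofCoeffs ι x a)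
  have e₁ := h.term_mul (exists_term_mul hx hγ) (hd.trans ((congrArg _ hc).trans (ofCoeffs_smul _ _).symm)) hs ht hst
  have e₂ := h.term_mul (exists_term_mul hx hγ) hc ht hs hts
  rw [Finsupp.smul_apply, smul_eq_mul, map_mul, mul_assoc, add_comm s t, e₂] at e₁
  have ha : IsTerm ι φ x s (φ ⟨a s, mem_nonZeroDivisors_of_ne_zero
    (Finsupp.mem_support_iff.mp hs)⟩) (ι (a s) * mon x s) := ⟨_, rfl, rfl⟩
  have hb : IsTerm ι φ x t (φ ⟨b t, mem_nonZeroDivisors_of_ne_zero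
    (Finsupp.mem_support_iff.mp ht)⟩) (ι (b t) * mon x t) := ⟨_, rfl, rfl⟩
  obtain ⟨k, hk⟩ := mon_mul_mon hx hγ t s
  have hts' : IsTerm ι φ x (t + s) (φ k) (mon x t * mon x s) := ⟨k, rfl, hk⟩
  obtain ⟨e, he, hst'⟩ := SkewCommute.mon_mon hx hγ s t
  have hst'' := hts'.coeff_mul e
  rw [← hst', add_comm] at hst''
  have h₁ := IsTerm.mul hx hst'' ha hb
  have h₂ := (IsTerm.mul hx hts' hb ha).coeff_mul d
  rw [e₁, add_comm] at h₂
  have := h₁.value_unique h h₂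
  rw [← he]
  generalize φ ⟨a s, _⟩ = α at this
  generalize φ ⟨b t, _⟩ = β at this
  rw [mul_comm β α, mul_left_comm] at this
  exact (mul_right_cancel this).symm

/-- Used to show that `γ` is alternating: `γ i i = 1` and `γ i j * γ j i = 1`. -/
theorem coeff_eq_one_of_var_mul_var (h : IsQuasiCommutative ι x)
    (hx : ∀ i, SkewNormal ι φ (x i)) (hγ : ∀ i j, SkewCommute ι φ (x i) (x j) (γ i j))
    {i j : Fin n} {d : R⁰} (hd : x i * x j = ι d * (x i * x j)) : d = 1 := by
  obtain ⟨k, hk⟩ := mon_mul_mon hx hγ (Pi.single i 1) (Pi.single j 1)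
  rw [mon_single, mon_single] at hk
  rw [hk, ← mul_assoc, ← map_mul] at hd
  have := h.coeff_injective hd
  exact Subtype.ext (mul_right_cancel₀ (nonZeroDivisors.ne_zero k.2)
    ((one_mul (k : R)).trans this)).symm

theorem exists_eq_coeff_mul_var (hn : 3 ≤ n) (h : IsQuasiCommutative ι x)
    (hx : ∀ i, SkewNormal ι φ (x i)) (hγ : ∀ i j, SkewCommute ι φ (x i) (x j) (γ i j))
    (hind : LinearIndependent ℤ fun p : {p : Fin n × Fin n // p.1 < p.2} =>
      Additive.ofMul (γ p.1.1 p.1.2))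
    {y : Fin n → A} (hy : ∀ i, y i ≠ 0) (hyγ : ∀ i j, SkewCommute ι φ (y i) (y j) (γ i j)) :
    ∃ l : Fin n → R, (∀ w, l w ≠ 0) ∧ ∀ w, y w = ι (l w) * x w := by
  choose a ha using fun i => h.exists_ofCoeffs (y i)
  have hne (i : Fin n) : (a i).support.Nonempty := by
    rw [Finsupp.support_nonempty_iff]
    intro h0
    exact hy i (by rw [ha, h0, map_zero])
  have hdiag (i : Fin n) : Additive.ofMul (γ i i) = 0 := by
    obtain ⟨d, hd, e⟩ := hγ i i
    rw [← hd, coeff_eq_one_of_var_mul_var h hx hγ e, map_one, ofMul_one]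
  have hanti (i j : Fin n) : Additive.ofMul (γ j i) = -Additive.ofMul (γ i j) := by
    obtain ⟨d, hd, e⟩ := hγ i j
    obtain ⟨d', hd', e'⟩ := hγ j i
    rw [e', ← mul_assoc, ← map_mul] at e
    have h1 : d * d' = 1 := coeff_eq_one_of_var_mul_var h hx hγ e
    have h2 : φ d * φ d' = 1 := by rw [← map_mul, h1, map_one]
    rw [← ofMul_inv, ← hd, ← hd', eq_inv_of_mul_eq_one_right h2]
  have key (t : Fin n → Fin n → ℕ) (ht : ∀ i, t i ∈ (a i).support)
      (hu : ∀ i j, UniqueAdd (a i).support (a j).support (t i) (t j)) (i : Fin n) :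
      t i = Pi.single i 1 := by
    refine eq_single_of_linearIndependent hn (fun i j => Additive.ofMul (γ i j)) hdiag hanti hind t
      (fun i j => ?_) i
    have hij := hyγ i j
    rw [ha i, ha j] at hij
    rw [hij.value_eq h hx hγ (ht i) (ht j) (hu i j) (hu j i)]
    simp only [ofMul_prod, ofMul_pow]
  -- Largest and smallest exponents of each `y i`; both satisfy the uniqueness required by `key`.
  choose s hs hs' using fun i => Finset.exists_max_image _ toLex (hne i)
  choose t ht ht' using fun i => Finset.exists_min_image _ toLex (hne i)
  have hs1 := key s hs fun i j => uniqueAdd_of_toLex_le (hs' i) (hs' j)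
  have ht1 := key t ht fun i j => uniqueAdd_of_le_toLex (ht' i) (ht' j)
  refine ⟨fun i => a i (Pi.single i 1), fun i => ?_, fun i => ?_⟩
  · dsimp only
    rw [← hs1 i]
    exact Finsupp.mem_support_iff.mp (hs i)
  · have hsub : (a i).support ⊆ {Pi.single i 1} := fun u hu => by
      rw [Finset.mem_singleton]
      exact toLex.injective (le_antisymm (hs1 i ▸ hs' i u hu) (ht1 i ▸ ht' i u hu))
    conv_lhs => rw [ha i, Finsupp.support_subset_singleton.mp hsub]
    rw [ofCoeffs_single, mon_single]

end LeadingTerms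

/-! ### Passage between `A` and its localization -/

section Fractions

variable {R A : Type*} [Ring R] [IsDomain R] [OreLocalization.OreSet R⁰] [Ring A] {n : ℕ}
  {ι : R →+* A} {x : Fin n → A}

/-- A nonzero element of `R` as a unit of `S⁻¹R`. -/
noncomputable def fracUnit (R : Type*) [Ring R] [IsDomain R] [OreLocalization.OreSet R⁰] :
    R⁰ →* (FracR R)ˣ where
  toFun := OreLocalization.numeratorUnit
  map_one' := Units.ext OreLocalization.one_def.symm
  map_mul' s t := Units.ext (OreLocalization.numeratorHom.map_mul (s : R) (t : R))

theorem coeffLoc_fracUnit (h : IsQuasiCommutative ι x) (s : R⁰) :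
    coeffLoc h (fracUnit R s : FracR R) = toLoc h (ι s) :=
  OreLocalization.universalHom_commutes ((toLoc h).comp ι) (denomUnit h) fun _ => rfl

theorem toLoc_injective (h : IsQuasiCommutative ι x) : Function.Injective (toLoc h) := by
  let _ := oreSet h
  refine OreLocalization.numeratorHom_inj ?_
  rintro _ ⟨s, hs, rfl⟩ f hf
  obtain ⟨a, rfl⟩ := h.exists_ofCoeffs f
  have h0 : ofCoeffs ι x (s • a) = ofCoeffs ι x 0 := by
    rw [map_zero, ofCoeffs_smul, hf]
  have h1 := h.ofCoeffs_injective h0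
  rw [smul_eq_zero_iff_right (nonZeroDivisors.ne_zero hs)] at h1
  rw [h1, map_zero]

/-- An element of `S⁻¹R` is determined by its product with a standard monomial. -/
theorem eq_fracUnit_of_coeffLoc_mul (h : IsQuasiCommutative ι x) {c : FracR R} {d k : R⁰}
    {t : Fin n → ℕ}
    (hc : coeffLoc h c * toLoc h (ι k * mon x t) = toLoc h (ι d * (ι k * mon x t))) :
    c = fracUnit R d := by
  induction c using OreLocalization.ind with
  | _ r s =>
    have e₁ : coeffLoc h (r /ₒ s) = ((denomUnit h s)⁻¹ : (Loc h)ˣ) * toLoc h (ι r) :=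
      OreLocalization.universalHom_apply _ _ _
    rw [e₁, mul_assoc, Units.inv_mul_eq_iff_eq_mul] at hc
    change _ = toLoc h (ι s) * _ at hc
    rw [← map_mul, ← map_mul] at hc
    have e₂ := toLoc_injective h hc
    simp only [← mul_assoc, ← map_mul] at e₂
    -- With `c = s⁻¹ r`, clearing the denominator leaves an identity in `A`, where the basis
    -- property applies.
    have e₃ : r = s * d := mul_right_cancel₀ (nonZeroDivisors.ne_zero k.2) (h.coeff_injective e₂)
    rw [e₃]
    change _ = (d : R) /ₒ (1 : R⁰)
    rw [OreLocalization.oreDiv_eq_iff]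
    exact ⟨s, 1, by simp [Submonoid.smul_def], by simp⟩

end Fractions

end SkewPBW

/-! ### The main theorem -/

theorem mainTheorem7 {R : Type*} {A : Type*} [Ring R] [IsDomain R]
    [OreLocalization.OreSet (nonZeroDivisors R)] [Ring A] {n : ℕ} (hn : 3 ≤ n)
    (ι : R →+* A) (x : Fin n → A) (hA : SkewPBW.IsQuasiCommutative ι x)
    (hgen : SkewPBW.IsGeneral (SkewPBW.coeffLoc hA) (fun i => SkewPBW.toLoc hA (x i))) :
    (∀ f ∈ SkewPBW.End ι, Function.Injective f →
      ∃ l : Fin n → R, (∀ w, l w ≠ 0) ∧ ∀ w, f (x w) = ι (l w) * x w) ∧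
    (∀ f : SkewPBW.Aut ι,
      ∃ l : Fin n → R, (∀ w, l w ≠ 0) ∧
        ∀ w, (f : SkewPBW.End ι).1 (x w) = ι (l w) * x w) := by
  open SkewPBW in
  obtain ⟨c, hc, hind⟩ := hgen
  let N := subgroupN (coeffLoc hA) fun i => toLoc hA (x i)
  let φ : nonZeroDivisors R →* (FracR R)ˣ ⧸ N := (QuotientGroup.mk' N).comp (fracUnit R)
  have hx (i : Fin n) : SkewNormal ι φ (x i) := by
    intro r
    obtain ⟨s, hs, e⟩ := hA.var_mul_coeff i r (nonZeroDivisors.ne_zero r.2)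
    refine ⟨⟨s, mem_nonZeroDivisors_of_ne_zero hs⟩, ?_, e⟩
    refine (QuotientGroup.eq.mpr (?_ : _ ∈ N)).symm
    -- In the localization `s` is the image of `r` under the endomorphism attached to `x i`, so `r⁻¹
    -- s` is a generator of `N`.
    refine Subgroup.subset_closure (Or.inr ⟨i, fracUnit R r, _, ?_, rfl⟩)
    rw [coeffLoc_fracUnit, coeffLoc_fracUnit, ← map_mul, ← map_mul, e]
  choose d hd0 hd using hA.var_mul_var
  have hγ' (i j : Fin n) : SkewCommute ι φ (x i) (x j)
      (φ ⟨d j i, mem_nonZeroDivisors_of_ne_zero (hd0 j i)⟩) := ⟨_, rfl, hd j i⟩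
  -- The units `c i j` are only given in `S⁻¹R`; the relation determines them, so they come from
  -- `R`. The indices of `d` are swapped as in `var_mul_var`.
  have hcd (i j : Fin n) : c i j = fracUnit R ⟨d j i, mem_nonZeroDivisors_of_ne_zero (hd0 j i)⟩ := by
    obtain ⟨k, hk⟩ := mon_mul_mon hx hγ' (Pi.single j 1) (Pi.single i 1)
    rw [mon_single, mon_single] at hk
    refine Units.ext (eq_fracUnit_of_coeffLoc_mul hA (k := k) (t := Pi.single j 1 + Pi.single i 1) ?_)
    rw [← hk, map_mul (toLoc hA) (x j), ← hc, ← map_mul, hd j i]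
  have hγ (i j : Fin n) : SkewCommute ι φ (x i) (x j) (QuotientGroup.mk (c i j)) := by
    rw [hcd]
    exact hγ' i j
  have main (f : A →+* A) (hf : f ∈ End ι) (hinj : Function.Injective f) :
      ∃ l : Fin n → R, (∀ w, l w ≠ 0) ∧ ∀ w, f (x w) = ι (l w) * x w := by
    refine exists_eq_coeff_mul_var hn hA hx hγ hind (fun i hi => ?_) fun i j => ?_
    -- Injectivity of `f` serves only to give `f (x i) ≠ 0`.
    · have h0 : ofCoeffs ι x (Finsupp.single (Pi.single i 1) 1) = ofCoeffs ι x 0 := by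
        rw [ofCoeffs_single, mon_single, map_one, one_mul, map_zero]
        exact hinj (hi.trans (map_zero f).symm)
      exact one_ne_zero (Finsupp.single_eq_zero.mp (hA.ofCoeffs_injective h0))
    · obtain ⟨e, he, hij⟩ := hγ i j
      exact ⟨e, he, by rw [← map_mul, hij, map_mul, hf, map_mul]⟩
  refine ⟨main, fun f => main _ f.val.2 fun a b hab => ?_⟩
  have hinv : (f⁻¹ : Aut ι).val.1.comp f.val.1 = RingHom.id A := congrArg Subtype.val f.inv_mul
  have := congrArg (f⁻¹ : Aut ι).val.1 hab
  rwa [← RingHom.comp_apply, ← RingHom.comp_apply, hinv] at this
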